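/- Let $q\in\mathbb C$ with $0<|q|<1$, write $(x;q)_n=\prod_{j=0}^{n-1}(1-xq^j)$, $(x;q)_\infty=\lim_{n\to\infty}(x;q)_n$, $(x_1,\dots,x_m;q)_n=(x_1;q)_n\cdots(x_m;q)_n$ (for $n\in\mathbb N_0\cup\{\infty\}$), and $\Omega_q=\{q^{-k}:k=0,1,2,\dots\}$. For $b_1,\dots,b_s\notin\Omega_q$ let $$ {}_r\phi_s\left({a_1,\dots,a_r\atop b_1,\dots,b_s};q,z\right)=\sum_{k=0}^\infty\frac{(a_1,\dots,a_r;q)_k}{(q,b_1,\dots,b_s;q)_k}\left((-1)^kq^{\binom k2}\right)^{1+s-r}z^k, $$ and for an integer $p\ge 0$ let $$ {}_{r+1}W_r^{p}(a;a_4,\dots,a_{r+1};q,z)={}_{r+1}\phi_{r+p}\left({a,\,q\sqrt a,\,-q\sqrt a,\,a_4,\dots,a_{r+1}\atop \sqrt a,\,-\sqrt a,\,\frac{qa}{a_4},\dots,\frac{qa}{a_{r+1}},\,0,\dots,0};q,z\right) $$ with $p$ zeros among the denominator parameters. Let $a,b,c,d\in\mathbb C\setminus\{0\}$ with $\pm\sqrt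 a,\ \frac{qa}{b},\ \frac{qa}{c},\ \frac{qa}{d}\notin\Omega_q$. (i) Let $e\in\mathbb C\setminus\{0\}$ with $\frac{qa}{e}\notin\Omega_q$, and suppose that $\left|\frac{qa}{de}\right|<1$ or that the ${}_3\phi_2$ below terminates (that is, one of $\frac{qa}{bc},d,e$ lies in $\Omega_q$). Then both series below converge absolutely and $$ {}_7W_6^{1}\left(a;b,c,d,e;q,\frac{q^2a^2}{bcde}\right)=\frac{(qa,\frac{qa}{de};q)_\infty}{(\frac{qa}{d},\frac{qa}{e};q)_\infty}\;{}_3\phi_2\left({\frac{qa}{bc},d,e\atop \frac{qa}{b},\frac{qa}{c}};q,\frac{qa}{de}\right). $$ (ii) Both series below converge absolutely and $$ {}_6W_5^{2}\left(a;b,c,d;q,\frac{q^2a^2}{bcd}\right)=\frac{(qa;q)_\infty}{(\frac{qa}{d};q)_\infty}\;{}_2\phi_2\left({\frac{qa}{bc},d\atop \frac{qa}{b},\frac{qa}{c}};q,\frac{qa}{d}\right). $$ If moreover $\left|\frac{qa}{bd}\right|<1$ or the ${}_2\phi_1$ below terminates (that is, $b\in\Omega_q$ or $d\in\Omega_q$),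 then the ${}_2\phi_1$ converges absolutely and both sides are also equal to $$ \frac{(qa,\frac{qa}{bd};q)_\infty}{(\frac{qa}{b},\frac{qa}{d};q)_\infty}\;{}_2\phi_1\left({b,d\atop \frac{qa}{c}};q,\frac{qa}{bd}\right). $$ -/

import Mathlib

/-- The set `Ω_q = {q^{-k} : k = 0, 1, 2, …}`. -/
def OmegaQ (q : ℂ) : Set ℂ := {x | ∃ k : ℕ, x = (q ^ k)⁻¹}

/-- The finite `q`-shifted factorial `(a;q)_n = (1-a)(1-aq)⋯(1-aq^{n-1})`. -/
noncomputable def qPoch (a q : ℂ) (n : ℕ) : ℂ := ∏ j ∈ Finset.range n, (1 - a * q ^ j)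

/-- The infinite `q`-shifted factorial `(a;q)_∞` (used for `|q| < 1`). -/
noncomputable def qPochInf (a q : ℂ) : ℂ := ∏' j : ℕ, (1 - a * q ^ j)

/-- For `|q| < 1` the infinite `q`-shifted factorial is the limit of the finite ones. -/
theorem tendsto_qPoch (a q : ℂ) (hq : ‖q‖ < 1) :
    Filter.Tendsto (qPoch a q) Filter.atTop (nhds (qPochInf a q)) := by
  have hs : Summable fun j : ℕ => ‖-(a * q ^ j)‖ := by
    simpa [norm_mul, norm_pow] using
      (summable_geometric_of_lt_one (norm_nonneg q) hq).mul_left ‖a‖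
  have hm : Multipliable fun j : ℕ => 1 + -(a * q ^ j) :=
    multipliable_one_add_of_summable hs
  have h := hm.hasProd.tendsto_prod_nat
  simp only [← sub_eq_add_neg] at h
  exact h

/-- The product `(a_1,…,a_r;q)_n = (a_1;q)_n ⋯ (a_r;q)_n`. -/
noncomputable def qPochList (as : List ℂ) (q : ℂ) (n : ℕ) : ℂ :=
  (as.map fun a => qPoch a q n).prod

/-- The product `(a_1,…,a_r;q)_∞ = (a_1;q)_∞ ⋯ (a_r;q)_∞`. -/
noncomputable def qPochInfList (as : List ℂ) (q : ℂ) : ℂ :=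
  (as.map fun a => qPochInf a q).prod

/-- The `k`-th term of the basic hypergeometric series `_rφ_s(as; bs; q, z)`,
where `r` and `s` are the lengths of the lists `as` and `bs`. -/
noncomputable def phiTerm (as bs : List ℂ) (q z : ℂ) (k : ℕ) : ℂ :=
  qPochList as q k / (qPoch q q k * qPochList bs q k)
    * ((-1) ^ k * q ^ k.choose 2) ^ (1 + (bs.length : ℤ) - (as.length : ℤ)) * z ^ k

/-- The basic hypergeometric series `_rφ_s(as; bs; q, z)`. -/
noncomputable def phi (as bs : List ℂ) (q z : ℂ) : ℂ := ∑' k : ℕ, phiTerm as bs q z k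

/-- The numerator parameters of `_{r+1}φ_s^p`: `-p` zeros are added if `p < 0`. -/
def zeroNum (p : ℤ) (as : List ℂ) : List ℂ := as ++ List.replicate (-p).toNat 0

/-- The denominator parameters of `_{r+1}φ_s^p`: `p` zeros are added if `p > 0`. -/
def zeroDen (p : ℤ) (bs : List ℂ) : List ℂ := bs ++ List.replicate p.toNat 0

/-- The numerator parameters `a, q√a, -q√a, a_4, …, a_{r+1}` of a very-well-poised series. -/
noncomputable def vwpNum (a : ℂ) (as : List ℂ) (q : ℂ) : List ℂ :=
  [a, q * a.sqrt, -(q * a.sqrt)] ++ as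

/-- The denominator parameters `√a, -√a, qa/a_4, …, qa/a_{r+1}` of a very-well-poised series. -/
noncomputable def vwpDen (a : ℂ) (as : List ℂ) (q : ℂ) : List ℂ :=
  [a.sqrt, -a.sqrt] ++ as.map fun x => q * a / x

/-- The `k`-th term of `_{r+1}W_r^p(a; a_4, …, a_{r+1}; q, z)`. -/
noncomputable def vwpTerm (p : ℤ) (a : ℂ) (as : List ℂ) (q z : ℂ) (k : ℕ) : ℂ :=
  phiTerm (zeroNum p (vwpNum a as q)) (zeroDen p (vwpDen a as q)) q z k

/-- The very-well-poised series `_{r+1}W_r^p(a; a_4, …, a_{r+1}; q, z)` with `p` vanishing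
denominator parameters; here `as = [a_4, …, a_{r+1}]`. -/
noncomputable def vwp (p : ℤ) (a : ℂ) (as : List ℂ) (q z : ℂ) : ℂ :=
  ∑' k : ℕ, vwpTerm p a as q z k

/-!
Multiply both sides of (i) by `(qa / e; q)_∞` and put `x = 1 / e`. Since `x ^ k (1 / x; q)_k` is a
polynomial in `x`, both sides become analytic functions of `x` near `0`, and at `x = q ^ N` both
series terminate. There the identity is Bailey's lemma for the Bailey pair given by the terminating
very-well-poised `₆φ₅` sum. As `q ^ N → 0`, the identity theorem yields (i), and `x = 0` is the
first formula of (ii). For the `₂φ₁`, apply (i) with the parameters `b, c, d, e` replaced by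
`c, e, b, d` and let `e → ∞`.
-/

open Filter Topology Finset

section Shifted

variable {q x : ℂ}

lemma mul_pow_ne_one (hx : x ∉ OmegaQ q) (k : ℕ) : x * q ^ k ≠ 1 := fun h =>
  hx ⟨k, eq_inv_of_mul_eq_one_left h⟩

lemma one_sub_mul_pow_ne_zero (hx : x ∉ OmegaQ q) (k : ℕ) : 1 - x * q ^ k ≠ 0 :=
  sub_ne_zero.2 (mul_pow_ne_one hx k).symm

lemma one_sub_ne_zero_of_notMem_OmegaQ (hx : x ∉ OmegaQ q) : 1 - x ≠ 0 := by
  simpa using one_sub_mul_pow_ne_zero hx 0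

lemma mul_pow_notMem_OmegaQ (hq0 : q ≠ 0) (hx : x ∉ OmegaQ q) (k : ℕ) : x * q ^ k ∉ OmegaQ q := by
  rintro ⟨j, hj⟩
  refine hx ⟨k + j, ?_⟩
  rw [pow_add, mul_inv, ← hj]
  field_simp

lemma mul_notMem_OmegaQ (hq0 : q ≠ 0) (hx : x ∉ OmegaQ q) : x * q ∉ OmegaQ q := by
  simpa using mul_pow_notMem_OmegaQ hq0 hx 1

lemma notMem_OmegaQ_of_norm_lt_one (hq0 : q ≠ 0) (hq1 : ‖q‖ < 1) (hx : ‖x‖ < 1) :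
    x ∉ OmegaQ q := by
  rintro ⟨k, rfl⟩
  rw [norm_inv, norm_pow] at hx
  exact hx.not_ge (one_le_inv_iff₀.2
    ⟨pow_pos (norm_pos_iff.2 hq0) k, pow_le_one₀ (norm_nonneg q) hq1.le⟩)

lemma zero_notMem_OmegaQ (hq0 : q ≠ 0) : (0 : ℂ) ∉ OmegaQ q := by
  rintro ⟨k, hk⟩
  exact inv_ne_zero (pow_ne_zero k hq0) hk.symm

@[simp]
lemma qPoch_zero (x q : ℂ) : qPoch x q 0 = 1 := by simp [qPoch]

lemma qPoch_succ (x q : ℂ) (n : ℕ) : qPoch x q (n + 1) = qPoch x q n * (1 - x * q ^ n) :=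
  prod_range_succ _ n

lemma qPoch_add (x q : ℂ) (m n : ℕ) :
    qPoch x q (m + n) = qPoch x q m * qPoch (x * q ^ m) q n := by
  simp only [qPoch, prod_range_add, pow_add, mul_assoc]

lemma qPoch_succ_left (x q : ℂ) (n : ℕ) : qPoch x q (n + 1) = (1 - x) * qPoch (x * q) q n := by
  rw [add_comm, qPoch_add, qPoch_succ]
  simp

lemma qPoch_ne_zero (hx : x ∉ OmegaQ q) (n : ℕ) : qPoch x q n ≠ 0 :=
  prod_ne_zero_iff.2 fun j _ => one_sub_mul_pow_ne_zero hx j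

lemma qPoch_mul_eq_div (hx : x ∉ OmegaQ q) (n : ℕ) :
    qPoch (x * q) q n = qPoch x q n * (1 - x * q ^ n) / (1 - x) := by
  rw [eq_div_iff (one_sub_ne_zero_of_notMem_OmegaQ hx), ← qPoch_succ, qPoch_succ_left, mul_comm]

@[simp]
lemma qPoch_zero_left (q : ℂ) (n : ℕ) : qPoch 0 q n = 1 := by simp [qPoch]

lemma exists_forall_qPoch_eq_zero (hq0 : q ≠ 0) (hx : x ∈ OmegaQ q) :
    ∃ n, ∀ k, n ≤ k → qPoch x q k = 0 := by
  obtain ⟨n, rfl⟩ := hx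
  exact ⟨n + 1, fun k hk => prod_eq_zero (mem_range.2 hk) (by simp [hq0])⟩

end Shifted

/-- The polynomial `x ^ k * (x⁻¹; q)_k` in `x`. A parameter `e` of a series enters through
`(e; q)_k * e⁻¹ ^ k = qPochInv q e⁻¹ k`, so that `e → ∞` becomes evaluation at `x = 0`. -/
noncomputable def qPochInv (q x : ℂ) (k : ℕ) : ℂ := ∏ j ∈ range k, (x - q ^ j)

/-- The `q`-binomial coefficient `(-1) ^ k q ^ (k choose 2) [N, k]_q` with its sign and power of
`q`, as a polynomial in `x = q ^ N`. -/
noncomputable def signedQBinom (q x : ℂ) (k : ℕ) : ℂ := qPochInv q x k / qPoch q q k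

section SignedQBinom

variable {q : ℂ}

lemma qPochInv_inv {e : ℂ} (he : e ≠ 0) (q : ℂ) (k : ℕ) :
    qPochInv q e⁻¹ k = qPoch e q k * e⁻¹ ^ k := by
  rw [qPoch, qPochInv, ← card_range k, ← prod_const, card_range, ← prod_mul_distrib]
  exact prod_congr rfl fun j _ => by field_simp

lemma qPochInv_zero_left (q : ℂ) (k : ℕ) : qPochInv q 0 k = (-1) ^ k * q ^ k.choose 2 := by
  simp only [qPochInv, zero_sub, prod_neg, card_range]
  rw [prod_pow_eq_pow_sum (range k) (fun j => j), sum_range_id, Nat.choose_two_right]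

lemma qPochInv_succ (q x : ℂ) (k : ℕ) :
    qPochInv q x (k + 1) = qPochInv q x k * (x - q ^ k) :=
  prod_range_succ _ k

lemma qPochInv_succ_mul (q x : ℂ) (k : ℕ) :
    qPochInv q (x * q) (k + 1) = (x * q - 1) * q ^ k * qPochInv q x k := by
  have hfactor (j : ℕ) : x * q - q ^ (j + 1) = q * (x - q ^ j) := by ring
  simp only [qPochInv, prod_range_succ', hfactor, prod_mul_distrib, prod_const, card_range,
    pow_zero]
  ring

lemma qPochInv_pow_of_lt (q : ℂ) {N k : ℕ} (h : N < k) : qPochInv q (q ^ N) k = 0 :=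
  prod_eq_zero (mem_range.2 h) (sub_self _)

lemma qPochInv_add_mul (q x : ℂ) (r m : ℕ) :
    qPochInv q (x * q ^ r) (r + m) = qPochInv q (x * q ^ r) r * (q ^ (r * m) * qPochInv q x m) := by
  have hfactor (j : ℕ) : x * q ^ r - q ^ (r + j) = q ^ r * (x - q ^ j) := by ring
  simp only [qPochInv, prod_range_add, hfactor, prod_mul_distrib, prod_const, card_range, pow_mul]

lemma qPochInv_pow_add (q : ℂ) (r m : ℕ) :
    qPochInv q (q ^ (m + r)) r * qPoch q q m = (-1) ^ r * q ^ r.choose 2 * qPoch q q (m + r) := by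
  induction r with
  | zero => simp [qPochInv]
  | succ r ih =>
    rw [← add_assoc, pow_succ, qPochInv_succ_mul, mul_assoc, ih, qPoch_succ q q (m + r),
      Nat.choose_succ_succ' r 1, Nat.choose_one_right]
    ring

@[simp]
lemma signedQBinom_zero (q x : ℂ) : signedQBinom q x 0 = 1 := by simp [signedQBinom, qPochInv]

lemma signedQBinom_pow_of_lt (q : ℂ) {N k : ℕ} (h : N < k) : signedQBinom q (q ^ N) k = 0 := by
  rw [signedQBinom, qPochInv_pow_of_lt q h, zero_div]

lemma signedQBinom_succ_mul (hq : q ∉ OmegaQ q) (x : ℂ) (k : ℕ) :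
    signedQBinom q (x * q) (k + 1) =
      q ^ (k + 1) * signedQBinom q x (k + 1) + -q ^ k * signedQBinom q x k := by
  have h1 := qPoch_ne_zero hq k
  have h2 := one_sub_mul_pow_ne_zero hq k
  simp only [signedQBinom, qPochInv_succ_mul, qPochInv_succ q x, qPoch_succ]
  field_simp
  ring

lemma signedQBinom_succ_mul_of_wellPoised (hq : q ∉ OmegaQ q) (a x : ℂ) (k : ℕ) :
    (1 - a * (x * q)) * signedQBinom q (x * q) (k + 1) =
      (1 - a * q ^ (k + 2) * x) * signedQBinom q x (k + 1) +
        -(x * (1 - a * q ^ (k + 1))) * signedQBinom q x k := by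
  have h1 := qPoch_ne_zero hq k
  have h2 := one_sub_mul_pow_ne_zero hq k
  simp only [signedQBinom, qPochInv_succ_mul, qPochInv_succ q x, qPoch_succ]
  field_simp
  ring

lemma signedQBinom_mul_signedQBinom (hq : q ∉ OmegaQ q) (x : ℂ) (r m : ℕ) :
    signedQBinom q (x * q ^ r) (r + m) * signedQBinom q (q ^ (r + m)) r =
      (-1) ^ r * q ^ r.choose 2 * q ^ (r * m) *
        (signedQBinom q (x * q ^ r) r * signedQBinom q x m) := by
  have h1 := qPoch_ne_zero hq r
  have h2 := qPoch_ne_zero hq m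
  have h3 := qPoch_ne_zero hq (m + r)
  have hr : qPochInv q (q ^ (m + r)) r =
      (-1) ^ r * q ^ r.choose 2 * qPoch q q (m + r) / qPoch q q m :=
    (eq_div_iff h2).2 (qPochInv_pow_add q r m)
  rw [signedQBinom, signedQBinom, qPochInv_add_mul, add_comm r m, hr, signedQBinom, signedQBinom]
  field_simp

end SignedQBinom

lemma sum_mul_range_add_two_of_recurrence {R : Type*} [CommRing R] {u v X Y : ℕ → R} {n : ℕ}
    (hu : u (n + 1) = 0) (h0 : v 0 = X 0 * u 0)
    (hv : ∀ r, v (r + 1) = X (r + 1) * u (r + 1) + Y r * u r) (F : ℕ → R) :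
    ∑ r ∈ range (n + 2), v r * F r =
      ∑ r ∈ range (n + 1), u r * (X r * F r + Y r * F (r + 1)) := by
  have hX : ∑ r ∈ range (n + 2), X r * u r * F r = ∑ r ∈ range (n + 1), X r * u r * F r := by
    rw [sum_range_succ, hu, mul_zero, zero_mul, add_zero]
  calc ∑ r ∈ range (n + 2), v r * F r
      = ∑ r ∈ range (n + 1), Y r * u r * F (r + 1) + ∑ r ∈ range (n + 2), X r * u r * F r := by
        simp only [sum_range_succ' _ (n + 1), h0, hv, add_mul, sum_add_distrib]
        ring
    _ = _ := by
        rw [hX, ← sum_add_distrib]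
        exact sum_congr rfl fun r _ => by ring

theorem q_chu_vandermonde {q : ℂ} (hq0 : q ≠ 0) (hq : q ∉ OmegaQ q) {D E : ℂ}
    (h : D * E ∉ OmegaQ q) (M : ℕ) :
    ∑ m ∈ range (M + 1), signedQBinom q (q ^ M) m * (qPoch D q m / qPoch (D * E) q m * E ^ m) =
      qPoch E q M / qPoch (D * E) q M := by
  induction M generalizing E with
  | zero => simp
  | succ M ih =>
    have h' : D * (E * q) ∉ OmegaQ q := by simpa [mul_assoc] using mul_notMem_OmegaQ hq0 h
    rw [sum_mul_range_add_two_of_recurrence (X := fun r => q ^ r) (Y := fun r => -q ^ r)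
        (signedQBinom_pow_of_lt q M.lt_succ_self) (by simp)
        (fun r => by rw [pow_succ q M]; exact signedQBinom_succ_mul hq (q ^ M) r),
      qPoch_succ_left, qPoch_succ_left, mul_assoc D, mul_div_mul_comm, ← ih h', mul_sum]
    refine sum_congr rfl fun m _ => ?_
    have h1 := qPoch_ne_zero h m
    have h2 := one_sub_mul_pow_ne_zero h m
    have h3 := one_sub_ne_zero_of_notMem_OmegaQ h
    rw [← mul_assoc D, qPoch_mul_eq_div h, qPoch_succ, qPoch_succ]
    generalize hv : 1 - D * E * q ^ m = v at h2 ⊢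
    field_simp
    linear_combination (-qPoch D q m * E ^ m * q ^ m * signedQBinom q (q ^ M) m) * hv

section BaileyPair

/-- The factors `(1 - a q ^ (2 r)) (b, c; q)_r / (qa / b, qa / c; q)_r (qa / (b c)) ^ r` of a
very-well-poised series which do not depend on the length of the series. -/
noncomputable def wellPoisedTerm (q a b c : ℂ) (r : ℕ) : ℂ :=
  (1 - a * q ^ (2 * r)) * (qPoch b q r * qPoch c q r /
    (qPoch (q * a / b) q r * qPoch (q * a / c) q r)) * (q * a / (b * c)) ^ r

/-- The terminating very-well-poised `₆φ₅` sum, up to the normalisation by `(q; q)_n`. -/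
noncomputable def wellPoisedSum (q a b c : ℂ) (n : ℕ) : ℂ :=
  ∑ r ∈ range (n + 1), signedQBinom q (q ^ n) r *
    (wellPoisedTerm q a b c r / qPoch (a * q ^ r) q (n + 1))

variable {q a b c : ℂ}

lemma mul_sq_div_mul (hq0 : q ≠ 0) (a b : ℂ) : q * (a * q ^ 2) / (b * q) = q * a / b * q := by
  field_simp

lemma mul_sq_div_mul_mul (hq0 : q ≠ 0) (a b c : ℂ) :
    q * (a * q ^ 2) / (b * q * (c * q)) = q * a / (b * c) := by
  field_simp

lemma wellPoisedTerm_succ (hq0 : q ≠ 0) (a b c : ℂ) (r : ℕ) :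
    wellPoisedTerm q a b c (r + 1) =
      q * a / (b * c) * ((1 - b) * (1 - c) / ((1 - q * a / b) * (1 - q * a / c))) *
        wellPoisedTerm q (a * q ^ 2) (b * q) (c * q) r := by
  simp only [wellPoisedTerm, mul_sq_div_mul hq0, mul_sq_div_mul_mul hq0, qPoch_succ_left]
  rw [mul_mul_mul_comm (1 - b), mul_mul_mul_comm (1 - q * a / b), mul_div_mul_comm]
  ring

lemma wellPoisedSum_succ (hq0 : q ≠ 0) (hq : q ∉ OmegaQ q) (ha : a ∉ OmegaQ q) (b c : ℂ) (n : ℕ) :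
    (1 - a * q ^ (n + 1)) * wellPoisedSum q a b c (n + 1) =
      wellPoisedSum q a b c n -
        q ^ n * (q * a / (b * c) * ((1 - b) * (1 - c) / ((1 - q * a / b) * (1 - q * a / c)))) *
          wellPoisedSum q (a * q ^ 2) (b * q) (c * q) n := by
  have hX (r : ℕ) : (1 - a * q ^ (r + 1) * q ^ n) / qPoch (a * q ^ r) q (n + 2) =
      1 / qPoch (a * q ^ r) q (n + 1) := by
    have h := one_sub_mul_pow_ne_zero (mul_pow_notMem_OmegaQ hq0 ha r) (n + 1)
    rw [qPoch_succ _ _ (n + 1), show a * q ^ (r + 1) * q ^ n = a * q ^ r * q ^ (n + 1) by ring]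
    field_simp
  have hY (r : ℕ) : (1 - a * q ^ (r + 1)) / qPoch (a * q ^ (r + 1)) q (n + 2) =
      1 / qPoch (a * q ^ 2 * q ^ r) q (n + 1) := by
    have h := one_sub_mul_pow_ne_zero ha (r + 1)
    rw [qPoch_succ_left, show a * q ^ (r + 1) * q = a * q ^ 2 * q ^ r by ring]
    field_simp
  simp only [wellPoisedSum, mul_sum, ← mul_assoc (1 - a * q ^ (n + 1))]
  rw [sum_mul_range_add_two_of_recurrence (X := fun r => 1 - a * q ^ (r + 1) * q ^ n)
      (Y := fun r => -(q ^ n * (1 - a * q ^ (r + 1))))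
      (signedQBinom_pow_of_lt q n.lt_succ_self) (by simp [pow_succ', mul_assoc])
      (fun r => by rw [pow_succ q n]; exact signedQBinom_succ_mul_of_wellPoised hq a (q ^ n) r),
    ← sum_sub_distrib]
  refine sum_congr rfl fun r _ => ?_
  rw [wellPoisedTerm_succ hq0]
  linear_combination signedQBinom q (q ^ n) r * (wellPoisedTerm q a b c r * hX r -
    q ^ n * (q * a / (b * c) * ((1 - b) * (1 - c) / ((1 - q * a / b) * (1 - q * a / c))) *
      wellPoisedTerm q (a * q ^ 2) (b * q) (c * q) r) * hY r)

lemma qPoch_ratio_recurrence (hb : b ≠ 0) (hc : c ≠ 0)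
    (hB : q * a / b ∉ OmegaQ q) (hC : q * a / c ∉ OmegaQ q) (n : ℕ) :
    (1 - a * q ^ (n + 1)) * (qPoch (q * a / (b * c)) q (n + 1) /
        (qPoch (q * a / b) q (n + 1) * qPoch (q * a / c) q (n + 1))) =
      qPoch (q * a / (b * c)) q n / (qPoch (q * a / b) q n * qPoch (q * a / c) q n) -
        q ^ n * (q * a / (b * c) * ((1 - b) * (1 - c) / ((1 - q * a / b) * (1 - q * a / c)))) *
          (qPoch (q * a / (b * c)) q n /
            (qPoch (q * a / b * q) q n * qPoch (q * a / c * q) q n)) := by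
  have key : (1 - a * q ^ (n + 1)) * (1 - q * a / (b * c) * q ^ n) =
      (1 - q * a / b * q ^ n) * (1 - q * a / c * q ^ n) -
        q ^ n * (q * a / (b * c)) * ((1 - b) * (1 - c)) := by
    field_simp
    ring
  have hB0 := one_sub_ne_zero_of_notMem_OmegaQ hB
  have hC0 := one_sub_ne_zero_of_notMem_OmegaQ hC
  have hBn := one_sub_mul_pow_ne_zero hB n
  have hCn := one_sub_mul_pow_ne_zero hC n
  have hB' := qPoch_ne_zero hB n
  have hC' := qPoch_ne_zero hC n
  rw [qPoch_mul_eq_div hB, qPoch_mul_eq_div hC, qPoch_succ, qPoch_succ, qPoch_succ]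
  generalize q * a / b = B at *
  generalize q * a / c = C at *
  generalize q * a / (b * c) = w at *
  generalize 1 - B * q ^ n = u at *
  generalize 1 - C * q ^ n = v at *
  field_simp
  linear_combination qPoch w q n * key

theorem wellPoisedSum_eq (hq0 : q ≠ 0) (hq : q ∉ OmegaQ q) (hb : b ≠ 0) (hc : c ≠ 0)
    (ha : a ∉ OmegaQ q) (hB : q * a / b ∉ OmegaQ q) (hC : q * a / c ∉ OmegaQ q) (n : ℕ) :
    wellPoisedSum q a b c n =
      qPoch (q * a / (b * c)) q n / (qPoch (q * a / b) q n * qPoch (q * a / c) q n) := by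
  induction n generalizing a b c with
  | zero =>
    have h := one_sub_ne_zero_of_notMem_OmegaQ ha
    simp [wellPoisedSum, wellPoisedTerm, qPoch_succ, h]
  | succ n ih =>
    apply mul_left_cancel₀ (one_sub_mul_pow_ne_zero ha (n + 1))
    have hshift := ih (mul_ne_zero hb hq0) (mul_ne_zero hc hq0) (mul_pow_notMem_OmegaQ hq0 ha 2)
      (by simpa only [mul_sq_div_mul hq0] using mul_notMem_OmegaQ hq0 hB)
      (by simpa only [mul_sq_div_mul hq0] using mul_notMem_OmegaQ hq0 hC)
    simp only [mul_sq_div_mul hq0, mul_sq_div_mul_mul hq0] at hshift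
    rw [wellPoisedSum_succ hq0 hq ha, ih hb hc ha hB hC, hshift,
      qPoch_ratio_recurrence hb hc hB hC]

lemma sum_bailey_inner {d w : ℂ} (hq0 : q ≠ 0) (hq : q ∉ OmegaQ q) (ha : a ∉ OmegaQ q)
    (hw : w ∉ OmegaQ q) (hdw : d * w = q * a) (r M : ℕ) :
    ∑ m ∈ range (M + 1), signedQBinom q (q ^ (r + M)) (r + m) * qPoch d q (r + m) * w ^ (r + m) *
        (signedQBinom q (q ^ (r + m)) r / qPoch (a * q ^ r) q (r + m + 1)) =
      qPoch w q (r + M) * (signedQBinom q (q ^ (r + M)) r * ((-1) ^ r * q ^ r.choose 2) *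
        (qPoch d q r / qPoch w q r * w ^ r) / qPoch (a * q ^ r) q (r + M + 1)) := by
  have hDE : d * q ^ r * (w * q ^ r) = a * q ^ r * q ^ (r + 1) := by
    linear_combination q ^ r * q ^ r * hdw
  have hden (m : ℕ) : qPoch (a * q ^ r) q (r + m + 1) =
      qPoch (a * q ^ r) q (r + 1) * qPoch (d * q ^ r * (w * q ^ r)) q m := by
    rw [hDE, ← qPoch_add, add_right_comm]
  have hDE' : d * q ^ r * (w * q ^ r) ∉ OmegaQ q := by
    rw [hDE]
    exact mul_pow_notMem_OmegaQ hq0 (mul_pow_notMem_OmegaQ hq0 ha r) (r + 1)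
  have hwr := qPoch_ne_zero hw r
  calc _ = ∑ m ∈ range (M + 1), (-1) ^ r * q ^ r.choose 2 * signedQBinom q (q ^ (r + M)) r *
          qPoch d q r * w ^ r / qPoch (a * q ^ r) q (r + 1) * (signedQBinom q (q ^ M) m *
            (qPoch (d * q ^ r) q m / qPoch (d * q ^ r * (w * q ^ r)) q m * (w * q ^ r) ^ m)) := by
        refine sum_congr rfl fun m _ => ?_
        have hprod := signedQBinom_mul_signedQBinom hq (q ^ M) r m
        rw [← pow_add, add_comm M r] at hprod
        rw [hden, qPoch_add d]
        simp only [div_eq_mul_inv, mul_inv, mul_pow, ← pow_mul]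
        linear_combination qPoch d q r * qPoch (d * q ^ r) q m * w ^ (r + m) *
          (qPoch (a * q ^ r) q (r + 1))⁻¹ * (qPoch (d * q ^ r * (w * q ^ r)) q m)⁻¹ * hprod
    _ = _ := by
        rw [← mul_sum, q_chu_vandermonde hq0 hq hDE', hden, qPoch_add w]
        field_simp

theorem bailey_lemma {d w : ℂ} (hq0 : q ≠ 0) (hq : q ∉ OmegaQ q) (ha : a ∉ OmegaQ q)
    (hw : w ∉ OmegaQ q) (hdw : d * w = q * a) (α : ℕ → ℂ) (N : ℕ) :
    ∑ n ∈ range (N + 1), signedQBinom q (q ^ N) n * qPoch d q n * w ^ n *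
        ∑ r ∈ range (n + 1), signedQBinom q (q ^ n) r * (α r / qPoch (a * q ^ r) q (n + 1)) =
      qPoch w q N * ∑ r ∈ range (N + 1), signedQBinom q (q ^ N) r * ((-1) ^ r * q ^ r.choose 2) *
        (qPoch d q r / qPoch w q r * w ^ r) * (α r / qPoch (a * q ^ r) q (N + 1)) := by
  simp only [mul_sum, range_eq_Ico]
  rw [← sum_Ico_Ico_comm]
  refine sum_congr rfl fun r hr => ?_
  obtain ⟨M, rfl⟩ := Nat.exists_eq_add_of_le (Nat.lt_succ_iff.1 (mem_Ico.1 hr).2)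
  rw [sum_Ico_eq_sum_range, show r + M + 1 - r = M + 1 by omega]
  have hinner := congrArg (α r * ·) (sum_bailey_inner hq0 hq ha hw hdw r M)
  simp only [mul_sum] at hinner
  convert hinner using 1
  · exact sum_congr rfl fun m _ => by ring
  · ring

end BaileyPair

/-- The coefficients, free of `e`, of the expansion of the `₃φ₂` of part (i) in the polynomials
`qPochInv q e⁻¹ k`; the vanishing numerator parameter is the limit `e → ∞`. -/
noncomputable def phiCoeff (q a b c d : ℂ) (k : ℕ) : ℂ :=
  phiTerm [0, q * a / (b * c), d] [q * a / b, q * a / c] q (q * a / d) k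

/-- The coefficients, free of `e`, of the expansion of the very-well-poised series of part (i) in
the functions `qPochInv q e⁻¹ k / (qa / e; q)_k`; the quotient `(1 - a q ^ (2 k)) / (1 - a)`
replaces the parameters `±q√a` and `±√a`. -/
noncomputable def vwpCoeff (q a b c d : ℂ) (k : ℕ) : ℂ :=
  (1 - a * q ^ (2 * k)) / (1 - a) *
    phiTerm [a, b, c, d] [q * a / b, q * a / c, q * a / d, 0] q (q ^ 2 * a ^ 2 / (b * c * d)) k

section Watson

variable {q a b c d : ℂ}

lemma phiCoeff_eq (q a b c d : ℂ) (k : ℕ) :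
    phiCoeff q a b c d k = qPoch (q * a / (b * c)) q k * qPoch d q k /
      (qPoch q q k * (qPoch (q * a / b) q k * qPoch (q * a / c) q k)) * (q * a / d) ^ k := by
  simp [phiCoeff, phiTerm, qPochList]

lemma vwpCoeff_eq (q a b c d : ℂ) (k : ℕ) :
    vwpCoeff q a b c d k = (1 - a * q ^ (2 * k)) / (1 - a) *
      (qPoch a q k * (qPoch b q k * (qPoch c q k * qPoch d q k)) /
        (qPoch q q k * (qPoch (q * a / b) q k * (qPoch (q * a / c) q k * qPoch (q * a / d) q k))) *
        ((-1) ^ k * q ^ k.choose 2) * (q ^ 2 * a ^ 2 / (b * c * d)) ^ k) := by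
  simp [vwpCoeff, phiTerm, qPochList]

lemma phiCoeff_mul_qPochInv_pow (hq0 : q ≠ 0) (hq : q ∉ OmegaQ q) (hb : b ≠ 0) (hc : c ≠ 0)
    (ha : a ∉ OmegaQ q) (hB : q * a / b ∉ OmegaQ q) (hC : q * a / c ∉ OmegaQ q) (N n : ℕ) :
    phiCoeff q a b c d n * qPochInv q (q ^ N) n =
      signedQBinom q (q ^ N) n * qPoch d q n * (q * a / d) ^ n * wellPoisedSum q a b c n := by
  rw [wellPoisedSum_eq hq0 hq hb hc ha hB hC, phiCoeff_eq, signedQBinom]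
  field_simp

lemma qPoch_div_qPoch_shift (hq0 : q ≠ 0) (ha : a ∉ OmegaQ q) (N r : ℕ) :
    qPoch (q * a) q N / qPoch (a * q ^ r) q (N + 1) =
      qPoch a q r / ((1 - a) * qPoch (q * a * q ^ N) q r) := by
  have h0 := one_sub_ne_zero_of_notMem_OmegaQ ha
  have h1 := qPoch_ne_zero (mul_pow_notMem_OmegaQ hq0 ha r) (N + 1)
  have h2 : qPoch (q * a * q ^ N) q r ≠ 0 := by
    have := qPoch_ne_zero (mul_pow_notMem_OmegaQ hq0 ha (N + 1)) r
    rwa [pow_succ', ← mul_assoc, mul_comm a q] at this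
  have hleft : qPoch a q (N + 1 + r) = (1 - a) * qPoch (q * a) q N * qPoch (q * a * q ^ N) q r := by
    rw [qPoch_add, qPoch_succ_left, mul_comm a q, pow_succ', ← mul_assoc a, mul_comm a q]
  have hright := qPoch_add a q r (N + 1)
  rw [add_comm, hleft] at hright
  rw [div_eq_div_iff h1 (mul_ne_zero h0 h2)]
  linear_combination hright

lemma vwpCoeff_mul_qPochInv_pow (hq0 : q ≠ 0) (ha : a ∉ OmegaQ q) (N r : ℕ) :
    vwpCoeff q a b c d r * qPochInv q (q ^ N) r / qPoch (q * a * q ^ N) q r =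
      qPoch (q * a) q N * (signedQBinom q (q ^ N) r * ((-1) ^ r * q ^ r.choose 2) *
        (qPoch d q r / qPoch (q * a / d) q r * (q * a / d) ^ r) *
        (wellPoisedTerm q a b c r / qPoch (a * q ^ r) q (N + 1))) := by
  have hz : q ^ 2 * a ^ 2 / (b * c * d) = q * a / (b * c) * (q * a / d) := by ring
  have h := qPoch_div_qPoch_shift hq0 ha N r
  rw [vwpCoeff_eq, wellPoisedTerm, signedQBinom, hz, mul_pow]
  simp only [div_eq_mul_inv, mul_inv] at h ⊢
  linear_combination -((1 - a * q ^ (2 * r)) * qPochInv q (q ^ N) r * (qPoch q q r)⁻¹ *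
    ((-1) ^ r * q ^ r.choose 2) * (qPoch d q r * (qPoch (q * a * d⁻¹) q r)⁻¹ * (q * a * d⁻¹) ^ r) *
    (qPoch b q r * qPoch c q r * (qPoch (q * a * b⁻¹) q r)⁻¹ * (qPoch (q * a * c⁻¹) q r)⁻¹) *
    (q * a * (b⁻¹ * c⁻¹)) ^ r) * h

theorem watson_terminating_of_notMem (hq0 : q ≠ 0) (hq : q ∉ OmegaQ q) (hb : b ≠ 0) (hc : c ≠ 0)
    (hd : d ≠ 0) (ha : a ∉ OmegaQ q) (hB : q * a / b ∉ OmegaQ q) (hC : q * a / c ∉ OmegaQ q)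
    (hD : q * a / d ∉ OmegaQ q) (N : ℕ) :
    qPoch (q * a) q N / qPoch (q * a / d) q N *
        ∑ n ∈ range (N + 1), phiCoeff q a b c d n * qPochInv q (q ^ N) n =
      ∑ r ∈ range (N + 1), vwpCoeff q a b c d r * qPochInv q (q ^ N) r /
        qPoch (q * a * q ^ N) q r := by
  have hbailey := bailey_lemma hq0 hq ha hD (mul_div_cancel₀ (q * a) hd)
    (wellPoisedTerm q a b c) N
  simp only [phiCoeff_mul_qPochInv_pow hq0 hq hb hc ha hB hC, wellPoisedSum, hbailey,
    vwpCoeff_mul_qPochInv_pow hq0 ha, ← mul_sum]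
  rw [← mul_assoc, div_mul_cancel₀ _ (qPoch_ne_zero hD N)]

lemma countable_OmegaQ (q : ℂ) : (OmegaQ q).Countable := by
  refine (Set.countable_range fun k : ℕ => (q ^ k)⁻¹).mono ?_
  rintro _ ⟨k, rfl⟩
  exact ⟨k, rfl⟩

lemma eq_of_eqOn_compl_countable {Y : Type*} [TopologicalSpace Y] [T2Space Y] {f g : ℂ → Y}
    {s : Set ℂ} (hs : s.Countable) (h : Set.EqOn f g sᶜ) {x : ℂ} (hf : ContinuousAt f x)
    (hg : ContinuousAt g x) : f x = g x :=
  tendsto_nhds_unique_of_frequently_eq hf hg <|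
    (mem_closure_iff_frequently.1 (hs.dense_compl ℂ x)).mono h

@[fun_prop]
lemma continuous_qPoch (q : ℂ) (n : ℕ) : Continuous fun x => qPoch x q n := by
  unfold qPoch
  fun_prop

theorem watson_terminating (hq0 : q ≠ 0) (hq : q ∉ OmegaQ q) (hb : b ≠ 0) (hc : c ≠ 0)
    (hd : d ≠ 0) (ha : a ≠ 1) (hB : q * a / b ∉ OmegaQ q) (hC : q * a / c ∉ OmegaQ q)
    (hD : q * a / d ∉ OmegaQ q) {N : ℕ} (hN : q * a * q ^ N ∉ OmegaQ q) :
    qPoch (q * a) q N / qPoch (q * a / d) q N *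
        ∑ n ∈ range (N + 1), phiCoeff q a b c d n * qPochInv q (q ^ N) n =
      ∑ r ∈ range (N + 1), vwpCoeff q a b c d r * qPochInv q (q ^ N) r /
        qPoch (q * a * q ^ N) q r := by
  let bad : Set ℂ := OmegaQ q ∪ ((q * · / b) ⁻¹' OmegaQ q ∪
    ((q * · / c) ⁻¹' OmegaQ q ∪ (q * · / d) ⁻¹' OmegaQ q))
  have hpre {y : ℂ} (hy : y ≠ 0) : ((q * · / y) ⁻¹' OmegaQ q).Countable :=
    (countable_OmegaQ q).preimage fun u v huv =>
      mul_left_cancel₀ hq0 ((div_left_inj' hy).1 huv)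
  have hbad : bad.Countable :=
    (countable_OmegaQ q).union ((hpre hb).union ((hpre hc).union (hpre hd)))
  have hq' := qPoch_ne_zero hq
  have hB' := qPoch_ne_zero hB
  have hC' := qPoch_ne_zero hC
  have hD' := qPoch_ne_zero hD
  have hN' := qPoch_ne_zero hN
  have ha' : 1 - a ≠ 0 := sub_ne_zero.2 ha.symm
  refine eq_of_eqOn_compl_countable hbad (x := a)
    (f := fun a => qPoch (q * a) q N / qPoch (q * a / d) q N *
      ∑ n ∈ range (N + 1), phiCoeff q a b c d n * qPochInv q (q ^ N) n)
    (g := fun a => ∑ r ∈ range (N + 1), vwpCoeff q a b c d r * qPochInv q (q ^ N) r /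
      qPoch (q * a * q ^ N) q r) (fun x hx => ?_) ?_ ?_
  · simp only [bad, Set.compl_union, Set.mem_inter_iff, Set.mem_compl_iff, Set.mem_preimage] at hx
    exact watson_terminating_of_notMem hq0 hq hb hc hd hx.1 hx.2.1 hx.2.2.1 hx.2.2.2 N
  · simp only [phiCoeff_eq]
    fun_prop (disch := simp [*])
  · simp only [vwpCoeff_eq]
    fun_prop (disch := simp [*])

end Watson

section Convergence

variable {q : ℂ}

lemma prod_one_add_mul_pow_le_exp {t ρ : ℝ} (ht : 0 ≤ t) (hρ0 : 0 ≤ ρ) (hρ1 : ρ < 1) (n : ℕ) :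
    ∏ j ∈ range n, (1 + t * ρ ^ j) ≤ Real.exp (t * (1 - ρ)⁻¹) := by
  refine (Real.prod_one_add_le_exp_sum _ fun j => by positivity).trans ?_
  rw [← mul_sum]
  gcongr
  exact sum_le_hasSum _ (fun j _ => by positivity) (hasSum_geometric_of_lt_one hρ0 hρ1)

lemma norm_qPoch_le (hq1 : ‖q‖ < 1) {x : ℂ} {t : ℝ} (hx : ‖x‖ ≤ t) (n : ℕ) :
    ‖qPoch x q n‖ ≤ Real.exp (t * (1 - ‖q‖)⁻¹) := by
  refine le_trans ?_
    (prod_one_add_mul_pow_le_exp ((norm_nonneg x).trans hx) (norm_nonneg q) hq1 n)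
  rw [qPoch, norm_prod]
  refine prod_le_prod (fun _ _ => norm_nonneg _) fun j _ => (norm_sub_le _ _).trans ?_
  rw [norm_one, norm_mul, norm_pow]
  gcongr

lemma norm_qPochInf_le (hq1 : ‖q‖ < 1) {x : ℂ} {t : ℝ} (hx : ‖x‖ ≤ t) :
    ‖qPochInf x q‖ ≤ Real.exp (t * (1 - ‖q‖)⁻¹) :=
  le_of_tendsto (tendsto_qPoch x q hq1).norm (Eventually.of_forall fun n => norm_qPoch_le hq1 hx n)

lemma norm_qPochInv_le (hq1 : ‖q‖ < 1) {x : ℂ} {ρ : ℝ} (hρ : 0 < ρ) (hx : ‖x‖ ≤ ρ) (k : ℕ) :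
    ‖qPochInv q x k‖ ≤ Real.exp (ρ⁻¹ * (1 - ‖q‖)⁻¹) * ρ ^ k := by
  calc ‖qPochInv q x k‖ ≤ ∏ j ∈ range k, ((1 + ρ⁻¹ * ‖q‖ ^ j) * ρ) := by
        rw [qPochInv, norm_prod]
        refine prod_le_prod (fun _ _ => norm_nonneg _) fun j _ => (norm_sub_le _ _).trans ?_
        rw [norm_pow, add_mul, mul_right_comm, inv_mul_cancel₀ hρ.ne', one_mul, one_mul]
        gcongr
    _ = (∏ j ∈ range k, (1 + ρ⁻¹ * ‖q‖ ^ j)) * ρ ^ k := by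
        rw [prod_mul_distrib, prod_const, card_range]
    _ ≤ _ := by
        gcongr
        exact prod_one_add_mul_pow_le_exp (by positivity) (norm_nonneg q) hq1 k

lemma summable_norm_neg_mul_pow (hq1 : ‖q‖ < 1) (x : ℂ) :
    Summable fun j : ℕ => ‖-(x * q ^ j)‖ := by
  simpa only [norm_neg, norm_mul, norm_pow] using
    (summable_geometric_of_lt_one (norm_nonneg q) hq1).mul_left ‖x‖

lemma qPochInf_ne_zero (hq1 : ‖q‖ < 1) {x : ℂ} (hx : x ∉ OmegaQ q) : qPochInf x q ≠ 0 := by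
  simpa only [qPochInf, ← sub_eq_add_neg] using
    tprod_one_add_ne_zero_of_summable (f := fun j : ℕ => -(x * q ^ j))
      (fun j => by simpa only [← sub_eq_add_neg] using one_sub_mul_pow_ne_zero hx j)
      (summable_norm_neg_mul_pow hq1 x)

@[simp]
lemma qPochInf_zero_left (q : ℂ) : qPochInf 0 q = 1 := by simp [qPochInf]

lemma qPochInf_eq_mul (hq1 : ‖q‖ < 1) (x : ℂ) (n : ℕ) :
    qPochInf x q = qPoch x q n * qPochInf (x * q ^ n) q := by
  have h1 := (tendsto_qPoch x q hq1).comp (tendsto_add_atTop_nat n)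
  have h2 := (tendsto_qPoch (x * q ^ n) q hq1).const_mul (qPoch x q n)
  refine tendsto_nhds_unique h1 (h2.congr fun m => ?_)
  rw [Function.comp, ← qPoch_add, add_comm]

lemma tendsto_qPochList (hq1 : ‖q‖ < 1) (as : List ℂ) :
    Tendsto (qPochList as q) atTop (𝓝 (qPochInfList as q)) :=
  tendsto_list_prod as fun a _ => tendsto_qPoch a q hq1

lemma qPochInfList_ne_zero (hq1 : ‖q‖ < 1) {as : List ℂ} (has : ∀ a ∈ as, a ∉ OmegaQ q) :
    qPochInfList as q ≠ 0 := by
  simpa [qPochInfList, List.prod_eq_zero_iff] using fun a ha => qPochInf_ne_zero hq1 (has a ha)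

lemma exists_norm_phiTerm_le (hq0 : q ≠ 0) (hq1 : ‖q‖ < 1) (as : List ℂ) {bs : List ℂ}
    (hbs : ∀ b ∈ bs, b ∉ OmegaQ q) : ∃ C : ℝ, 0 ≤ C ∧ ∀ z k, ‖phiTerm as bs q z k‖ ≤
      C * ((‖q‖ ^ k.choose 2) ^ (1 + (bs.length : ℤ) - as.length) * ‖z‖ ^ k) := by
  have hq : q ∉ OmegaQ q := notMem_OmegaQ_of_norm_lt_one hq0 hq1 hq1
  have hne : qPochInfList (q :: bs) q ≠ 0 :=
    qPochInfList_ne_zero hq1 (List.forall_mem_cons.2 ⟨hq, hbs⟩)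
  obtain ⟨C, hC⟩ := ((tendsto_qPochList hq1 as).div (tendsto_qPochList hq1 (q :: bs))
    hne).norm.bddAbove_range
  have hC' (k : ℕ) : ‖qPochList as q k / (qPoch q q k * qPochList bs q k)‖ ≤ C := by
    simpa [qPochList] using hC ⟨k, rfl⟩
  refine ⟨C, (norm_nonneg _).trans (hC' 0), fun z k => ?_⟩
  rw [phiTerm, mul_assoc, norm_mul, norm_mul, norm_zpow, norm_mul, norm_pow, norm_pow, norm_pow,
    norm_neg, norm_one, one_pow, one_mul]
  gcongr
  exact hC' k

lemma summable_pow_choose_two_mul_pow {ρ : ℝ} (hρ0 : 0 < ρ) (hρ1 : ρ < 1) (w : ℝ) :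
    Summable fun k : ℕ => ρ ^ k.choose 2 * w ^ k := by
  rcases eq_or_ne w 0 with rfl | hw
  · exact summable_of_ne_finset_zero (s := {0}) fun k hk => by
      simp [zero_pow (show k ≠ 0 by simpa using hk)]
  refine summable_of_ratio_test_tendsto_lt_one (l := 0) zero_lt_one
    (Eventually.of_forall fun k => by positivity) ?_
  have h := (tendsto_pow_atTop_nhds_zero_of_lt_one hρ0.le hρ1).mul_const ‖w‖
  rw [zero_mul] at h
  refine h.congr fun k => ?_
  have hk : ρ ^ (k + 1).choose 2 * w ^ (k + 1) = ρ ^ k * w * (ρ ^ k.choose 2 * w ^ k) := by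
    rw [Nat.choose_succ_succ' k 1, Nat.choose_one_right]
    ring
  rw [hk, norm_mul, mul_div_cancel_right₀ _ (norm_ne_zero_iff.2 (by positivity)), norm_mul,
    Real.norm_of_nonneg (pow_nonneg hρ0.le k)]

lemma summable_phiTerm_of_length_le (hq0 : q ≠ 0) (hq1 : ‖q‖ < 1) {as bs : List ℂ}
    (hlen : as.length ≤ bs.length) (hbs : ∀ b ∈ bs, b ∉ OmegaQ q) (z : ℂ) :
    Summable (phiTerm as bs q z) := by
  obtain ⟨C, hC0, hC⟩ := exists_norm_phiTerm_le hq0 hq1 as hbs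
  obtain ⟨m, hm⟩ := Nat.exists_eq_add_of_le hlen
  refine .of_norm_bounded
    ((summable_pow_choose_two_mul_pow (norm_pos_iff.2 hq0) hq1 ‖z‖).mul_left C) fun k => ?_
  refine (hC z k).trans ?_
  have hexp : 1 + (bs.length : ℤ) - as.length = (m + 1 : ℕ) := by
    rw [hm]
    push_cast
    ring
  rw [hexp, zpow_natCast]
  gcongr
  exact pow_le_of_le_one (by positivity) (pow_le_one₀ (norm_nonneg q) hq1.le) m.succ_ne_zero

lemma summable_phiTerm_of_norm_lt_one (hq0 : q ≠ 0) (hq1 : ‖q‖ < 1) {as bs : List ℂ}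
    (hlen : as.length = bs.length + 1) (hbs : ∀ b ∈ bs, b ∉ OmegaQ q) {z : ℂ} (hz : ‖z‖ < 1) :
    Summable (phiTerm as bs q z) := by
  obtain ⟨C, -, hC⟩ := exists_norm_phiTerm_le hq0 hq1 as hbs
  refine .of_norm_bounded ((summable_geometric_of_lt_one (norm_nonneg z) hz).mul_left C)
    fun k => (hC z k).trans_eq ?_
  have hexp : 1 + (bs.length : ℤ) - as.length = 0 := by
    rw [hlen]
    push_cast
    ring
  rw [hexp, zpow_zero, one_mul]

lemma summable_phiTerm_of_mem (hq0 : q ≠ 0) {as : List ℂ} {a : ℂ} (ha : a ∈ as)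
    (haq : a ∈ OmegaQ q) (bs : List ℂ) (z : ℂ) : Summable (phiTerm as bs q z) := by
  obtain ⟨n, hn⟩ := exists_forall_qPoch_eq_zero hq0 haq
  refine summable_of_ne_finset_zero (s := range n) fun k hk => ?_
  have hzero : qPochList as q k = 0 :=
    List.prod_eq_zero (List.mem_map.2 ⟨a, ha, hn k (by simpa using hk)⟩)
  rw [phiTerm, hzero, zero_div, zero_mul, zero_mul]

lemma phiTerm_mul_arg (as bs : List ℂ) (q z w : ℂ) (k : ℕ) :
    phiTerm as bs q (z * w) k = phiTerm as bs q z k * w ^ k := by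
  simp only [phiTerm, mul_pow, mul_assoc]

lemma summable_norm_phiTerm_mul_pow {as bs : List ℂ} {z : ℂ} {ρ : ℝ} (hρ : 0 ≤ ρ)
    (h : Summable (phiTerm as bs q (z * ρ))) :
    Summable fun k => ‖phiTerm as bs q z k‖ * ρ ^ k := by
  simpa only [phiTerm_mul_arg, norm_mul, norm_pow, Complex.norm_real, Real.norm_of_nonneg hρ]
    using h.norm

lemma summable_phiTerm_of_norm_lt_one_or_mem (hq0 : q ≠ 0) (hq1 : ‖q‖ < 1) {as bs : List ℂ}
    (hlen : as.length = bs.length + 1) (hbs : ∀ b ∈ bs, b ∉ OmegaQ q) {z : ℂ}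
    (h : ‖z‖ < 1 ∨ ∃ a ∈ as, a ∈ OmegaQ q) : Summable (phiTerm as bs q z) :=
  h.elim (summable_phiTerm_of_norm_lt_one hq0 hq1 hlen hbs) fun ⟨_, ha, haq⟩ =>
    summable_phiTerm_of_mem hq0 ha haq bs z

end Convergence

section Differentiability

variable {q : ℂ}

lemma differentiable_qPochInf (hq1 : ‖q‖ < 1) : Differentiable ℂ fun x => qPochInf x q := by
  have h : HasProdLocallyUniformlyOn (fun (j : ℕ) (x : ℂ) => 1 + -(x * q ^ j))
      (fun x => ∏' j : ℕ, (1 + -(x * q ^ j))) Set.univ := by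
    refine hasProdLocallyUniformlyOn_of_forall_compact isOpen_univ fun K _ hK => ?_
    obtain ⟨C, hC⟩ := hK.isBounded.exists_norm_le
    refine Summable.hasProdUniformlyOn_nat_one_add hK
      ((summable_geometric_of_lt_one (norm_nonneg q) hq1).mul_left C)
      (Eventually.of_forall fun n x hx => ?_) fun n => by fun_prop
    rw [norm_neg, norm_mul, norm_pow]
    gcongr
    exact hC x hx
  have hd := TendstoLocallyUniformlyOn.differentiableOn h
    (Eventually.of_forall fun s => by fun_prop) isOpen_univ
  simp only [← sub_eq_add_neg, differentiableOn_univ] at hd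
  exact hd

@[fun_prop]
lemma differentiable_qPochInv (q : ℂ) (k : ℕ) : Differentiable ℂ fun x => qPochInv q x k := by
  unfold qPochInv
  fun_prop

lemma differentiableOn_tsum_qPochInv_mul (hq1 : ‖q‖ < 1) {c : ℕ → ℂ} {g : ℕ → ℂ → ℂ} {ρ B : ℝ}
    (hρ : 0 < ρ) (hc : Summable fun k => ‖c k‖ * ρ ^ k) (hg : ∀ k, Differentiable ℂ (g k))
    (hB : ∀ k, ∀ x ∈ Metric.ball (0 : ℂ) ρ, ‖g k x‖ ≤ B) :
    DifferentiableOn ℂ (fun x => ∑' k, c k * qPochInv q x k * g k x) (Metric.ball 0 ρ) := by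
  refine Complex.differentiableOn_tsum_of_summable_norm
    (hc.mul_right (Real.exp (ρ⁻¹ * (1 - ‖q‖)⁻¹) * B))
    (fun k => (((differentiable_qPochInv q k).const_mul (c k)).mul (hg k)).differentiableOn)
    Metric.isOpen_ball fun k x hx => ?_
  have hP := norm_qPochInv_le hq1 hρ (mem_ball_zero_iff.1 hx).le k
  calc ‖c k * qPochInv q x k * g k x‖
      ≤ ‖c k‖ * (Real.exp (ρ⁻¹ * (1 - ‖q‖)⁻¹) * ρ ^ k) * B := by
        rw [norm_mul, norm_mul]
        gcongr
        exact hB k x hx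
    _ = _ := by ring

end Differentiability

section VeryWellPoised

variable {q a : ℂ}

lemma ne_one_of_sqrt_notMem_OmegaQ (hs : a.sqrt ∉ OmegaQ q) : a ≠ 1 := by
  rintro rfl
  exact hs ⟨0, by simp⟩

lemma qPoch_mul_sqrt_div_qPoch_sqrt (hs : a.sqrt ∉ OmegaQ q) (hs' : -a.sqrt ∉ OmegaQ q) (k : ℕ) :
    qPoch (q * a.sqrt) q k * qPoch (-(q * a.sqrt)) q k / (qPoch a.sqrt q k * qPoch (-a.sqrt) q k) =
      (1 - a * q ^ (2 * k)) / (1 - a) := by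
  have hsq : a.sqrt ^ 2 = a := by
    rw [Complex.sqrt, ← Complex.cpow_nat_mul]
    simp
  have h1 := one_sub_ne_zero_of_notMem_OmegaQ hs
  have h2 := one_sub_ne_zero_of_notMem_OmegaQ hs'
  have hfactor : (1 - a * q ^ (2 * k)) / (1 - a) = (1 - a.sqrt * q ^ k) / (1 - a.sqrt) *
      ((1 - -a.sqrt * q ^ k) / (1 - -a.sqrt)) := by
    rw [div_mul_div_comm]
    congr 1
    · linear_combination q ^ (2 * k) * hsq
    · linear_combination hsq
  rw [hfactor, mul_div_mul_comm, ← mul_neg, mul_comm q, mul_comm q,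
    qPoch_mul_eq_div hs, qPoch_mul_eq_div hs']
  have h3 := qPoch_ne_zero hs k
  have h4 := qPoch_ne_zero hs' k
  field_simp

lemma vwpTerm_eq (hs : a.sqrt ∉ OmegaQ q) (hs' : -a.sqrt ∉ OmegaQ q) (p : ℤ) (as : List ℂ)
    (z : ℂ) (k : ℕ) :
    vwpTerm p a as q z k = (1 - a * q ^ (2 * k)) / (1 - a) *
      phiTerm (zeroNum p (a :: as)) (zeroDen p (as.map (q * a / ·))) q z k := by
  have hexp : 1 + ((zeroDen p (vwpDen a as q)).length : ℤ) - (zeroNum p (vwpNum a as q)).length =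
      1 + ((zeroDen p (as.map (q * a / ·))).length : ℤ) - (zeroNum p (a :: as)).length := by
    simp only [zeroNum, zeroDen, vwpNum, vwpDen, List.length_append, List.length_cons,
      List.length_nil, List.length_map]
    push_cast
    ring
  rw [← qPoch_mul_sqrt_div_qPoch_sqrt hs hs', vwpTerm, phiTerm, phiTerm, hexp]
  simp only [zeroNum, zeroDen, vwpNum, vwpDen, qPochList, List.map_append, List.map_cons,
    List.map_nil, List.prod_append, List.prod_cons, List.prod_nil]
  ring

lemma summable_vwpTerm (hq0 : q ≠ 0) (hq1 : ‖q‖ < 1) (hs : a.sqrt ∉ OmegaQ q)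
    (hs' : -a.sqrt ∉ OmegaQ q) {p : ℤ} (hp : 0 < p) {as : List ℂ}
    (has : ∀ x ∈ as, q * a / x ∉ OmegaQ q) (z : ℂ) : Summable (vwpTerm p a as q z) := by
  refine summable_phiTerm_of_length_le hq0 hq1 ?_ ?_ z
  · simp only [zeroNum, zeroDen, vwpNum, vwpDen, List.length_append, List.length_cons,
      List.length_nil, List.length_map, List.length_replicate]
    lia
  · have h0 := zero_notMem_OmegaQ hq0
    simp only [zeroDen, vwpDen, List.mem_append, List.mem_cons, List.not_mem_nil, or_false,
      List.mem_map, List.mem_replicate]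
    rintro b ((( rfl | rfl) | ⟨x, hx, rfl⟩) | ⟨-, rfl⟩)
    exacts [hs, hs', has x hx, h0]

lemma vwpTerm_perm {as as' : List ℂ} (h : as.Perm as') (p : ℤ) (a q z : ℂ) (k : ℕ) :
    vwpTerm p a as q z k = vwpTerm p a as' q z k := by
  simp only [vwpTerm, phiTerm, zeroNum, zeroDen, vwpNum, vwpDen, qPochList, List.map_append,
    List.prod_append, List.length_append, List.length_map, h.length_eq, List.map_map,
    (h.map _).prod_eq]

end VeryWellPoised

section Expansion

variable {q a b c d e : ℂ}

lemma vwpTerm_eq_vwpCoeff (hs : a.sqrt ∉ OmegaQ q) (hs' : -a.sqrt ∉ OmegaQ q) (b c d : ℂ) :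
    vwpTerm 1 a [b, c, d] q (q ^ 2 * a ^ 2 / (b * c * d)) = vwpCoeff q a b c d :=
  funext fun k => vwpTerm_eq hs hs' 1 [b, c, d] _ k

lemma vwpTerm_one_eq (hs : a.sqrt ∉ OmegaQ q) (hs' : -a.sqrt ∉ OmegaQ q) (he : e ≠ 0)
    (b c d : ℂ) (k : ℕ) :
    vwpTerm 1 a [b, c, d, e] q (q ^ 2 * a ^ 2 / (b * c * d * e)) k =
      vwpCoeff q a b c d k * qPochInv q e⁻¹ k / qPoch (q * a / e) q k := by
  rw [vwpTerm_eq hs hs', vwpCoeff, qPochInv_inv he, ← div_div, div_eq_mul_inv _ e, phiTerm_mul_arg]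
  simp only [phiTerm, qPochList, zeroNum, Int.reduceNeg, Int.reduceToNat, List.replicate_zero,
    List.append_nil, List.map_cons, List.map_nil, List.prod_cons, List.prod_nil, mul_one, zeroDen,
    Int.toNat_one, List.replicate_one, List.cons_append, List.nil_append, qPoch_zero_left,
    List.length_cons, List.length_nil, zero_add, Nat.reduceAdd, Nat.cast_ofNat, Int.reduceAdd,
    Int.reduceSub, zpow_ofNat, pow_one, inv_pow]
  ring

lemma vwpTerm_two_eq (hs : a.sqrt ∉ OmegaQ q) (hs' : -a.sqrt ∉ OmegaQ q) (b c d : ℂ) (k : ℕ) :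
    vwpTerm 2 a [b, c, d] q (q ^ 2 * a ^ 2 / (b * c * d)) k =
      vwpCoeff q a b c d k * qPochInv q 0 k := by
  rw [vwpTerm_eq hs hs', vwpCoeff, qPochInv_zero_left]
  simp only [phiTerm, qPochList, zeroNum, Int.reduceNeg, Int.reduceToNat, List.replicate_zero,
    List.append_nil, List.map_cons, List.map_nil, List.prod_cons, List.prod_nil, mul_one, zeroDen,
    List.reduceReplicate, List.cons_append, List.nil_append, qPoch_zero_left, List.length_cons,
    List.length_nil, zero_add, Nat.reduceAdd, Nat.cast_ofNat, Int.reduceAdd, Int.reduceSub,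
    zpow_ofNat, pow_one]
  ring

lemma phiTerm_three_two_eq (he : e ≠ 0) (q a b c d : ℂ) (k : ℕ) :
    phiTerm [q * a / (b * c), d, e] [q * a / b, q * a / c] q (q * a / (d * e)) k =
      phiCoeff q a b c d k * qPochInv q e⁻¹ k := by
  rw [phiCoeff, qPochInv_inv he, ← div_div _ d e, div_eq_mul_inv _ e, phiTerm_mul_arg]
  simp only [phiTerm, qPochList, List.map_cons, List.map_nil, List.prod_cons, List.prod_nil,
    mul_one, List.length_cons, List.length_nil, zero_add, Nat.reduceAdd, Nat.cast_ofNat,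
    Int.reduceAdd, sub_self, zpow_ofNat, pow_zero, inv_pow, qPoch_zero_left, one_mul]
  ring

lemma phiTerm_two_two_eq (q a b c d : ℂ) (k : ℕ) :
    phiTerm [q * a / (b * c), d] [q * a / b, q * a / c] q (q * a / d) k =
      phiCoeff q a b c d k * qPochInv q 0 k := by
  rw [phiCoeff, qPochInv_zero_left]
  simp only [phiTerm, qPochList, List.map_cons, List.map_nil, List.prod_cons, List.prod_nil,
    mul_one, List.length_cons, List.length_nil, zero_add, Nat.reduceAdd, Nat.cast_ofNat,
    Int.reduceAdd, Int.reduceSub, zpow_ofNat, pow_one, qPoch_zero_left, one_mul, sub_self, pow_zero]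
  ring

end Expansion

/-- `(qa / e; q)_∞` times the very-well-poised series of part (i), as a function of `x = e⁻¹`; in
contrast to the series it is entire, and its value at `0` is the series of part (ii). -/
noncomputable def vwpEntire (q a b c d x : ℂ) : ℂ :=
  ∑' k : ℕ, vwpCoeff q a b c d k * qPochInv q x k * qPochInf (q * a * x * q ^ k) q

/-- `(qa / e; q)_∞` times the right-hand side of part (i), as a function of `x = e⁻¹`. -/
noncomputable def phiProd (q a b c d x : ℂ) : ℂ :=
  qPochInf (q * a) q / qPochInf (q * a / d) q * qPochInf (q * a / d * x) q *
    ∑' k : ℕ, phiCoeff q a b c d k * qPochInv q x k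

section Continuation

variable {q a b c d x : ℂ}

lemma vwpEntire_eq_qPochInf_mul (hq1 : ‖q‖ < 1) (hx : q * a * x ∉ OmegaQ q) (b c d : ℂ) :
    vwpEntire q a b c d x = qPochInf (q * a * x) q *
      ∑' k, vwpCoeff q a b c d k * qPochInv q x k / qPoch (q * a * x) q k := by
  rw [vwpEntire, ← tsum_mul_left]
  refine tsum_congr fun k => ?_
  have h := qPoch_ne_zero hx k
  rw [qPochInf_eq_mul hq1 (q * a * x) k]
  field_simp

lemma tsum_eq_sum_range_of_qPochInv_pow (q : ℂ) (N : ℕ) (f : ℕ → ℂ → ℂ) (hf : ∀ k, f k 0 = 0) :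
    ∑' k, f k (qPochInv q (q ^ N) k) = ∑ k ∈ range (N + 1), f k (qPochInv q (q ^ N) k) :=
  tsum_eq_sum fun k hk => by rw [qPochInv_pow_of_lt q (by simpa using hk), hf]

theorem vwpEntire_pow_eq_phiProd (hq0 : q ≠ 0) (hq1 : ‖q‖ < 1) (hb : b ≠ 0) (hc : c ≠ 0)
    (hd : d ≠ 0) (ha : a ≠ 1) (hB : q * a / b ∉ OmegaQ q) (hC : q * a / c ∉ OmegaQ q)
    (hD : q * a / d ∉ OmegaQ q) {N : ℕ} (hN : q * a * q ^ N ∉ OmegaQ q) :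
    vwpEntire q a b c d (q ^ N) = phiProd q a b c d (q ^ N) := by
  have hq := notMem_OmegaQ_of_norm_lt_one hq0 hq1 hq1
  have hD' := qPochInf_ne_zero hq1 hD
  rw [qPochInf_eq_mul hq1 _ N] at hD'
  have h1 := left_ne_zero_of_mul hD'
  have h2 := right_ne_zero_of_mul hD'
  rw [vwpEntire_eq_qPochInf_mul hq1 hN, phiProd,
    tsum_eq_sum_range_of_qPochInv_pow q N
      (fun k y => vwpCoeff q a b c d k * y / qPoch (q * a * q ^ N) q k) (by simp),
    tsum_eq_sum_range_of_qPochInv_pow q N (fun k y => phiCoeff q a b c d k * y) (by simp),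
    ← watson_terminating hq0 hq hb hc hd ha hB hC hD hN, qPochInf_eq_mul hq1 (q * a) N,
    qPochInf_eq_mul hq1 (q * a / d) N]
  generalize qPochInf (q * a / d * q ^ N) q = D at h2 ⊢
  field_simp

lemma differentiable_vwpEntire (hq0 : q ≠ 0) (hq1 : ‖q‖ < 1) (hs : a.sqrt ∉ OmegaQ q)
    (hs' : -a.sqrt ∉ OmegaQ q) (hB : q * a / b ∉ OmegaQ q) (hC : q * a / c ∉ OmegaQ q)
    (hD : q * a / d ∉ OmegaQ q) : Differentiable ℂ (vwpEntire q a b c d) := by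
  intro x
  have hρ : 0 < ‖x‖ + 1 := by positivity
  have hc : Summable fun k => ‖vwpCoeff q a b c d k‖ * (‖x‖ + 1) ^ k := by
    rw [← vwpTerm_eq_vwpCoeff hs hs']
    exact summable_norm_phiTerm_mul_pow hρ.le
      (summable_vwpTerm hq0 hq1 hs hs' zero_lt_one (by simp [hB, hC, hD]) _)
  have hg (k : ℕ) : Differentiable ℂ fun y => qPochInf (q * a * y * q ^ k) q :=
    (differentiable_qPochInf hq1).comp (by fun_prop)
  refine (differentiableOn_tsum_qPochInv_mul hq1 hρ hc hg
    fun k y hy => norm_qPochInf_le hq1 (t := ‖q * a‖ * (‖x‖ + 1)) ?_).differentiableAt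
    (Metric.isOpen_ball.mem_nhds (by simp))
  rw [norm_mul, norm_mul (q * a), norm_pow]
  calc ‖q * a‖ * ‖y‖ * ‖q‖ ^ k ≤ ‖q * a‖ * ‖y‖ :=
        mul_le_of_le_one_right (by positivity) (pow_le_one₀ (norm_nonneg q) hq1.le)
    _ ≤ ‖q * a‖ * (‖x‖ + 1) := by
        gcongr
        exact (mem_ball_zero_iff.1 hy).le

lemma differentiableOn_phiProd (hq1 : ‖q‖ < 1) {ρ : ℝ} (hρ : 0 < ρ)
    (h : Summable fun k => ‖phiCoeff q a b c d k‖ * ρ ^ k) :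
    DifferentiableOn ℂ (phiProd q a b c d) (Metric.ball 0 ρ) := by
  have hsum := differentiableOn_tsum_qPochInv_mul (g := fun _ _ => 1) hq1 hρ h (by fun_prop)
    (B := 1) (by simp)
  simp only [mul_one] at hsum
  have hprod : Differentiable ℂ fun x => qPochInf (q * a / d * x) q :=
    (differentiable_qPochInf hq1).comp (by fun_prop)
  exact (hprod.const_mul _).differentiableOn.mul hsum

theorem eqOn_vwpEntire_phiProd (hq0 : q ≠ 0) (hq1 : ‖q‖ < 1) (hb : b ≠ 0) (hc : c ≠ 0)
    (hd : d ≠ 0) (hs : a.sqrt ∉ OmegaQ q) (hs' : -a.sqrt ∉ OmegaQ q) (hB : q * a / b ∉ OmegaQ q)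
    (hC : q * a / c ∉ OmegaQ q) (hD : q * a / d ∉ OmegaQ q) {ρ : ℝ} (hρ : 0 < ρ)
    (h : Summable fun k => ‖phiCoeff q a b c d k‖ * ρ ^ k) :
    Set.EqOn (vwpEntire q a b c d) (phiProd q a b c d) (Metric.ball 0 ρ) := by
  have hlim : Tendsto (fun N : ℕ => q ^ N) atTop (𝓝 0) :=
    tendsto_pow_atTop_nhds_zero_of_norm_lt_one hq1
  have hlim' : Tendsto (fun N : ℕ => q ^ N) atTop (𝓝[≠] 0) :=
    tendsto_nhdsWithin_iff.2 ⟨hlim, Eventually.of_forall fun N => pow_ne_zero N hq0⟩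
  have hsmall : ∀ᶠ N : ℕ in atTop, ‖q * a * q ^ N‖ < 1 := by
    have := (hlim.const_mul (q * a)).norm
    rw [mul_zero, norm_zero] at this
    exact this.eventually_lt_const zero_lt_one
  have hV := (differentiable_vwpEntire hq0 hq1 hs hs' hB hC hD).differentiableOn.analyticOnNhd
    (Metric.isOpen_ball (x := 0) (ε := ρ))
  have hP := (differentiableOn_phiProd hq1 hρ h).analyticOnNhd Metric.isOpen_ball
  refine hV.eqOn_of_preconnected_of_frequently_eq hP (convex_ball 0 ρ).isPreconnected
    (Metric.mem_ball_self hρ) (hlim'.frequently (Eventually.frequently ?_))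
  filter_upwards [hsmall] with N hN
  exact vwpEntire_pow_eq_phiProd hq0 hq1 hb hc hd (ne_one_of_sqrt_notMem_OmegaQ hs) hB hC hD
    (notMem_OmegaQ_of_norm_lt_one hq0 hq1 hN)

lemma exists_summable_phiCoeff_mul_pow (hq0 : q ≠ 0) (hq1 : ‖q‖ < 1)
    (hB : q * a / b ∉ OmegaQ q) (hC : q * a / c ∉ OmegaQ q)
    (h : ‖q * a / d * x‖ < 1 ∨ q * a / (b * c) ∈ OmegaQ q ∨ d ∈ OmegaQ q) :
    ∃ ρ : ℝ, ‖x‖ < ρ ∧ Summable fun k => ‖phiCoeff q a b c d k‖ * ρ ^ k := by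
  have key {ρ : ℝ} (hρ : ‖x‖ < ρ) (hρ' : ‖q * a / d * ρ‖ < 1 ∨
      ∃ y ∈ [0, q * a / (b * c), d], y ∈ OmegaQ q) :
      ∃ ρ : ℝ, ‖x‖ < ρ ∧ Summable fun k => ‖phiCoeff q a b c d k‖ * ρ ^ k :=
    ⟨ρ, hρ, summable_norm_phiTerm_mul_pow ((norm_nonneg x).trans hρ.le)
      (summable_phiTerm_of_norm_lt_one_or_mem hq0 hq1 (by simp) (by simp [hB, hC]) hρ')⟩
  rcases h with h | h
  · have hlt : ∀ᶠ ρ in 𝓝 ‖x‖, ‖q * a / d‖ * ρ < 1 :=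
      (Continuous.tendsto (by fun_prop) ‖x‖).eventually_lt_const (by rwa [← norm_mul])
    obtain ⟨ρ, hρ, hρ1⟩ := hlt.exists_gt
    refine key hρ (.inl ?_)
    rwa [norm_mul, Complex.norm_real, Real.norm_of_nonneg ((norm_nonneg x).trans hρ.le)]
  · exact key (lt_add_one ‖x‖) (.inr (by simpa using Or.inr h))

theorem vwpEntire_eq_phiProd (hq0 : q ≠ 0) (hq1 : ‖q‖ < 1) (hb : b ≠ 0) (hc : c ≠ 0)
    (hd : d ≠ 0) (hs : a.sqrt ∉ OmegaQ q) (hs' : -a.sqrt ∉ OmegaQ q) (hB : q * a / b ∉ OmegaQ q)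
    (hC : q * a / c ∉ OmegaQ q) (hD : q * a / d ∉ OmegaQ q)
    (h : ‖q * a / d * x‖ < 1 ∨ q * a / (b * c) ∈ OmegaQ q ∨ d ∈ OmegaQ q) :
    vwpEntire q a b c d x = phiProd q a b c d x := by
  obtain ⟨ρ, hρ, hsum⟩ := exists_summable_phiCoeff_mul_pow hq0 hq1 hB hC h
  exact eqOn_vwpEntire_phiProd hq0 hq1 hb hc hd hs hs' hB hC hD ((norm_nonneg x).trans_lt hρ) hsum
    (mem_ball_zero_iff.2 hρ)

end Continuation

section Transformation

variable {q a b c d e x : ℂ}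

lemma qPochInf_mul_vwp_one (hq1 : ‖q‖ < 1) (hs : a.sqrt ∉ OmegaQ q) (hs' : -a.sqrt ∉ OmegaQ q)
    (he : e ≠ 0) (hE : q * a / e ∉ OmegaQ q) (b c d : ℂ) :
    qPochInf (q * a / e) q * vwp 1 a [b, c, d, e] q (q ^ 2 * a ^ 2 / (b * c * d * e)) =
      vwpEntire q a b c d e⁻¹ := by
  rw [vwpEntire_eq_qPochInf_mul hq1 (by rwa [← div_eq_mul_inv]), vwp,
    funext (vwpTerm_one_eq hs hs' he b c d), div_eq_mul_inv]

lemma vwp_two_eq_vwpEntire_zero (hs : a.sqrt ∉ OmegaQ q) (hs' : -a.sqrt ∉ OmegaQ q) (b c d : ℂ) :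
    vwp 2 a [b, c, d] q (q ^ 2 * a ^ 2 / (b * c * d)) = vwpEntire q a b c d 0 := by
  simp only [vwp, vwpEntire, vwpTerm_two_eq hs hs', mul_zero, zero_mul, qPochInf_zero_left, mul_one]

lemma phiProd_zero (q a b c d : ℂ) :
    phiProd q a b c d 0 = qPochInf (q * a) q / qPochInf (q * a / d) q *
      phi [q * a / (b * c), d] [q * a / b, q * a / c] q (q * a / d) := by
  simp only [phiProd, phi, phiTerm_two_two_eq, mul_zero, qPochInf_zero_left, mul_one]

theorem vwp_one_eq_phi_three_two (hq0 : q ≠ 0) (hq1 : ‖q‖ < 1) (hb : b ≠ 0) (hc : c ≠ 0)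
    (hd : d ≠ 0) (hs : a.sqrt ∉ OmegaQ q) (hs' : -a.sqrt ∉ OmegaQ q) (hB : q * a / b ∉ OmegaQ q)
    (hC : q * a / c ∉ OmegaQ q) (hD : q * a / d ∉ OmegaQ q) (he : e ≠ 0)
    (hE : q * a / e ∉ OmegaQ q)
    (h : ‖q * a / (d * e)‖ < 1 ∨ q * a / (b * c) ∈ OmegaQ q ∨ d ∈ OmegaQ q ∨ e ∈ OmegaQ q) :
    vwp 1 a [b, c, d, e] q (q ^ 2 * a ^ 2 / (b * c * d * e)) =
      qPochInfList [q * a, q * a / (d * e)] q / qPochInfList [q * a / d, q * a / e] q *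
        phi [q * a / (b * c), d, e] [q * a / b, q * a / c] q (q * a / (d * e)) := by
  have hcont : vwpEntire q a b c d e⁻¹ = phiProd q a b c d e⁻¹ := by
    have hcont' := vwpEntire_eq_phiProd (x := e⁻¹) hq0 hq1 hb hc hd hs hs' hB hC hD
    rw [← div_eq_mul_inv, div_div] at hcont'
    rcases h with h | h | h | ⟨N, rfl⟩
    · exact hcont' (.inl h)
    · exact hcont' (.inr (.inl h))
    · exact hcont' (.inr (.inr h))
    · rw [inv_inv]
      exact vwpEntire_pow_eq_phiProd hq0 hq1 hb hc hd (ne_one_of_sqrt_notMem_OmegaQ hs) hB hC hD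
        (by rwa [div_inv_eq_mul] at hE)
  have hD' := qPochInf_ne_zero hq1 hD
  have hE' := qPochInf_ne_zero hq1 hE
  refine mul_left_cancel₀ hE' ?_
  rw [qPochInf_mul_vwp_one hq1 hs hs' he hE, hcont, phiProd, phi,
    funext (phiTerm_three_two_eq he q a b c d), ← div_eq_mul_inv, div_div]
  simp only [qPochInfList, List.map_cons, List.map_nil, List.prod_cons, List.prod_nil, mul_one]
  generalize qPochInf (q * a / e) q = E at hE' ⊢
  generalize qPochInf (q * a / d) q = D at hD' ⊢
  field_simp

theorem vwp_two_eq_phi_two_two (hq0 : q ≠ 0) (hq1 : ‖q‖ < 1) (hb : b ≠ 0) (hc : c ≠ 0)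
    (hd : d ≠ 0) (hs : a.sqrt ∉ OmegaQ q) (hs' : -a.sqrt ∉ OmegaQ q) (hB : q * a / b ∉ OmegaQ q)
    (hC : q * a / c ∉ OmegaQ q) (hD : q * a / d ∉ OmegaQ q) :
    vwp 2 a [b, c, d] q (q ^ 2 * a ^ 2 / (b * c * d)) =
      qPochInf (q * a) q / qPochInf (q * a / d) q *
        phi [q * a / (b * c), d] [q * a / b, q * a / c] q (q * a / d) := by
  rw [vwp_two_eq_vwpEntire_zero hs hs', ← phiProd_zero]
  exact vwpEntire_eq_phiProd hq0 hq1 hb hc hd hs hs' hB hC hD (.inl (by simp))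

lemma tendsto_tsum_mul_qPoch_mul_qPochInf (hq1 : ‖q‖ < 1) {f : ℕ → ℂ} (hf : Summable f)
    (u v : ℂ) :
    Tendsto (fun x => ∑' k, f k * (qPoch (x * u) q k * qPochInf (x * v * q ^ k) q)) (𝓝 0)
      (𝓝 (∑' k, f k)) := by
  have hball : ∀ᶠ x : ℂ in 𝓝 0, ‖x‖ < 1 :=
    (continuous_norm.tendsto' 0 0 norm_zero).eventually_lt_const zero_lt_one
  refine tendsto_tsum_of_dominated_convergence (hf.norm.mul_right
    (Real.exp (‖u‖ * (1 - ‖q‖)⁻¹) * Real.exp (‖v‖ * (1 - ‖q‖)⁻¹))) (fun k => ?_) ?_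
  · have hcont : Continuous fun x => f k * (qPoch (x * u) q k * qPochInf (x * v * q ^ k) q) :=
      continuous_const.mul (((continuous_qPoch q k).comp (by fun_prop)).mul
        ((differentiable_qPochInf hq1).continuous.comp (by fun_prop)))
    simpa using hcont.tendsto 0
  · filter_upwards [hball] with x hx k
    have hu : ‖x * u‖ ≤ ‖u‖ := by
      rw [norm_mul]
      exact mul_le_of_le_one_left (norm_nonneg u) hx.le
    have hv : ‖x * v * q ^ k‖ ≤ ‖v‖ := by
      rw [norm_mul, norm_mul, norm_pow, mul_right_comm]
      exact mul_le_of_le_one_left (norm_nonneg v)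
        (mul_le_one₀ hx.le (by positivity) (pow_le_one₀ (norm_nonneg q) hq1.le))
    rw [norm_mul, norm_mul]
    gcongr
    exacts [norm_qPoch_le hq1 hu k, norm_qPochInf_le hq1 hv]

lemma qPochInf_mul_phiTerm_three_two (hq1 : ‖q‖ < 1) (hx : x ≠ 0)
    (hX : x * (q * a) ∉ OmegaQ q) (b c d : ℂ) (k : ℕ) :
    qPochInf (q * a / x⁻¹) q *
        phiTerm [q * a / (c * x⁻¹), b, d] [q * a / c, q * a / x⁻¹] q (q * a / (b * d)) k =
      phiTerm [b, d] [q * a / c] q (q * a / (b * d)) k *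
        (qPoch (x * (q * a / c)) q k * qPochInf (x * (q * a) * q ^ k) q) := by
  have h := qPoch_ne_zero hX k
  have hu : q * a / (c * x⁻¹) = x * (q * a / c) := by field_simp
  have hv : q * a / x⁻¹ = x * (q * a) := by rw [div_inv_eq_mul, mul_comm]
  rw [hu, hv, qPochInf_eq_mul hq1 _ k]
  simp only [phiTerm, qPochList, List.map_cons, List.map_nil, List.prod_cons, List.prod_nil,
    mul_one, List.length_cons, List.length_nil, zero_add, Nat.reduceAdd, Nat.cast_ofNat,
    Int.reduceAdd, sub_self, zpow_ofNat, pow_zero, Nat.cast_one]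
  generalize qPoch (x * (q * a)) q k = Z at h ⊢
  field_simp

theorem vwpEntire_eq_tsum_phiTerm (hq0 : q ≠ 0) (hq1 : ‖q‖ < 1) (hb : b ≠ 0) (hc : c ≠ 0)
    (hd : d ≠ 0) (hs : a.sqrt ∉ OmegaQ q) (hs' : -a.sqrt ∉ OmegaQ q) (hB : q * a / b ∉ OmegaQ q)
    (hC : q * a / c ∉ OmegaQ q) (hD : q * a / d ∉ OmegaQ q)
    (h : ‖q * a / (b * d)‖ < 1 ∨ b ∈ OmegaQ q ∨ d ∈ OmegaQ q) (hx : x ≠ 0)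
    (hX : x * (q * a) ∉ OmegaQ q) :
    vwpEntire q a b c d x =
      qPochInfList [q * a, q * a / (b * d)] q / qPochInfList [q * a / b, q * a / d] q *
        ∑' k, phiTerm [b, d] [q * a / c] q (q * a / (b * d)) k *
          (qPoch (x * (q * a / c)) q k * qPochInf (x * (q * a) * q ^ k) q) := by
  have hx' := inv_ne_zero hx
  have hX' : q * a / x⁻¹ ∉ OmegaQ q := by rwa [div_inv_eq_mul, mul_comm]
  have hperm : vwp 1 a [b, c, d, x⁻¹] q (q ^ 2 * a ^ 2 / (b * c * d * x⁻¹)) =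
      vwp 1 a [c, x⁻¹, b, d] q (q ^ 2 * a ^ 2 / (c * x⁻¹ * b * d)) := by
    have harg : b * c * d * x⁻¹ = c * x⁻¹ * b * d := by ring
    rw [harg]
    unfold vwp
    refine tsum_congr fun k => vwpTerm_perm ?_ ..
    exact (List.perm_append_comm (l₁ := [b]) (l₂ := [c, d, x⁻¹])).trans
      (((List.perm_append_comm (l₁ := [d]) (l₂ := [x⁻¹, b])).cons c))
  have hvwp := qPochInf_mul_vwp_one hq1 hs hs' hx' hX' b c d
  rw [inv_inv] at hvwp
  rw [← hvwp, hperm,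
    vwp_one_eq_phi_three_two hq0 hq1 hc hx' hb hs hs' hC hX' hB hd hD (h.imp_right .inr),
    mul_left_comm, phi, ← tsum_mul_left]
  simp only [qPochInf_mul_phiTerm_three_two hq1 hx hX]

lemma summable_phiTerm_two_one (hq0 : q ≠ 0) (hq1 : ‖q‖ < 1) (hC : q * a / c ∉ OmegaQ q)
    (h : ‖q * a / (b * d)‖ < 1 ∨ b ∈ OmegaQ q ∨ d ∈ OmegaQ q) :
    Summable (phiTerm [b, d] [q * a / c] q (q * a / (b * d))) :=
  summable_phiTerm_of_norm_lt_one_or_mem hq0 hq1 (by simp) (by simpa using hC) (by simpa using h)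

theorem vwp_two_eq_phi_two_one (hq0 : q ≠ 0) (hq1 : ‖q‖ < 1) (hb : b ≠ 0) (hc : c ≠ 0)
    (hd : d ≠ 0) (hs : a.sqrt ∉ OmegaQ q) (hs' : -a.sqrt ∉ OmegaQ q) (hB : q * a / b ∉ OmegaQ q)
    (hC : q * a / c ∉ OmegaQ q) (hD : q * a / d ∉ OmegaQ q)
    (h : ‖q * a / (b * d)‖ < 1 ∨ b ∈ OmegaQ q ∨ d ∈ OmegaQ q) :
    vwp 2 a [b, c, d] q (q ^ 2 * a ^ 2 / (b * c * d)) =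
      qPochInfList [q * a, q * a / (b * d)] q / qPochInfList [q * a / b, q * a / d] q *
        phi [b, d] [q * a / c] q (q * a / (b * d)) := by
  rw [vwp_two_eq_vwpEntire_zero hs hs']
  have hsum := summable_phiTerm_two_one hq0 hq1 hC h
  have hleft : Tendsto (vwpEntire q a b c d) (𝓝[≠] 0) (𝓝 (vwpEntire q a b c d 0)) :=
    ((differentiable_vwpEntire hq0 hq1 hs hs' hB hC hD).continuous.tendsto 0).mono_left
      nhdsWithin_le_nhds
  have hright := ((tendsto_tsum_mul_qPoch_mul_qPochInf hq1 hsum (q * a / c) (q * a)).const_mul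
    (qPochInfList [q * a, q * a / (b * d)] q / qPochInfList [q * a / b, q * a / d] q)).mono_left
      (nhdsWithin_le_nhds (s := {0}ᶜ))
  have hsmall : ∀ᶠ x : ℂ in 𝓝 0, ‖x * (q * a)‖ < 1 :=
    (Continuous.tendsto' (by fun_prop) 0 0 (by simp)).eventually_lt_const zero_lt_one
  refine tendsto_nhds_unique_of_eventuallyEq hleft hright ?_
  filter_upwards [nhdsWithin_le_nhds hsmall, self_mem_nhdsWithin] with x hx hx0
  exact vwpEntire_eq_tsum_phiTerm hq0 hq1 hb hc hd hs hs' hB hC hD h hx0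
    (notMem_OmegaQ_of_norm_lt_one hq0 hq1 hx)

end Transformation

theorem theorem2p2 (q a b c d : ℂ) (hq0 : q ≠ 0) (hq1 : ‖q‖ < 1)
    (ha : a ≠ 0) (hb : b ≠ 0) (hc : c ≠ 0) (hd : d ≠ 0)
    (hsa : a.sqrt ∉ OmegaQ q) (hsa' : -a.sqrt ∉ OmegaQ q)
    (hqb : q * a / b ∉ OmegaQ q) (hqc : q * a / c ∉ OmegaQ q) (hqd : q * a / d ∉ OmegaQ q) :
    (∀ e : ℂ, e ≠ 0 → q * a / e ∉ OmegaQ q →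
      -- the `₃φ₂` converges: its argument is in the unit disc, or it terminates
      (‖q * a / (d * e)‖ < 1 ∨
        q * a / (b * c) ∈ OmegaQ q ∨ d ∈ OmegaQ q ∨ e ∈ OmegaQ q) →
      Summable (vwpTerm 1 a [b, c, d, e] q (q ^ 2 * a ^ 2 / (b * c * d * e))) ∧
      Summable (phiTerm [q * a / (b * c), d, e] [q * a / b, q * a / c] q (q * a / (d * e))) ∧
      vwp 1 a [b, c, d, e] q (q ^ 2 * a ^ 2 / (b * c * d * e)) =
        qPochInfList [q * a, q * a / (d * e)] q / qPochInfList [q * a / d, q * a / e] q *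
          phi [q * a / (b * c), d, e] [q * a / b, q * a / c] q (q * a / (d * e))) ∧
    (Summable (vwpTerm 2 a [b, c, d] q (q ^ 2 * a ^ 2 / (b * c * d))) ∧
      Summable (phiTerm [q * a / (b * c), d] [q * a / b, q * a / c] q (q * a / d)) ∧
      vwp 2 a [b, c, d] q (q ^ 2 * a ^ 2 / (b * c * d)) =
        qPochInf (q * a) q / qPochInf (q * a / d) q *
          phi [q * a / (b * c), d] [q * a / b, q * a / c] q (q * a / d)) ∧
    -- the `₂φ₁` converges: its argument is in the unit disc, or it terminates
    ((‖q * a / (b * d)‖ < 1 ∨ b ∈ OmegaQ q ∨ d ∈ OmegaQ q) →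
      Summable (phiTerm [b, d] [q * a / c] q (q * a / (b * d))) ∧
      qPochInf (q * a) q / qPochInf (q * a / d) q *
          phi [q * a / (b * c), d] [q * a / b, q * a / c] q (q * a / d) =
        qPochInfList [q * a, q * a / (b * d)] q / qPochInfList [q * a / b, q * a / d] q *
          phi [b, d] [q * a / c] q (q * a / (b * d))) := by
  refine ⟨fun e he hqe h => ⟨?_, ?_, ?_⟩, ⟨?_, ?_, ?_⟩, fun h => ⟨?_, ?_⟩⟩
  · exact summable_vwpTerm hq0 hq1 hsa hsa' zero_lt_one (by simp [hqb, hqc, hqd, hqe]) _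
  · exact summable_phiTerm_of_norm_lt_one_or_mem hq0 hq1 (by simp) (by simp [hqb, hqc])
      (by simpa using h)
  · exact vwp_one_eq_phi_three_two hq0 hq1 hb hc hd hsa hsa' hqb hqc hqd he hqe h
  · exact summable_vwpTerm hq0 hq1 hsa hsa' zero_lt_two (by simp [hqb, hqc, hqd]) _
  · exact summable_phiTerm_of_length_le hq0 hq1 (by simp) (by simp [hqb, hqc]) _
  · exact vwp_two_eq_phi_two_two hq0 hq1 hb hc hd hsa hsa' hqb hqc hqd
  · exact summable_phiTerm_two_one hq0 hq1 hqc h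
  · rw [← vwp_two_eq_phi_two_two hq0 hq1 hb hc hd hsa hsa' hqb hqc hqd,
      vwp_two_eq_phi_two_one hq0 hq1 hb hc hd hsa hsa' hqb hqc hqd h]
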